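/- **Definitions.** A resistance form on a non-empty set $F$ is a pair $(\mathcal E,\mathcal F)$ such that: (RF1) $\mathcal F$ is a linear space of functions $F\to\mathbb R$ containing the constants, and $\mathcal E$ is a non-negative symmetric quadratic form on $\mathcal F$ with $\mathcal E(f,f)=0$ if and only if $f$ is constant; (RF2) $\mathcal F$ modulo constants, with $\mathcal E$, is a Hilbert space; (RF3) $\mathcal F$ separates the points of $F$; (RF4) $R(x,y):=\sup\{|f(x)-f(y)|^2/\mathcal E(f,f): f\in\mathcal F,\ \mathcal E(f,f)>0\}<\infty$ for all $x,y\in F$; (RF5) if $f\in\mathcal F$ and $\bar f=(f\wedge 1)\vee 0$, then $\bar f\in\mathcal F$ and $\mathcal E(\bar f,\bar f)\le\mathcal E(f,f)$. The function $R$ is the resistance metric. The form is regular if $\mathcal F\cap C_0(F)$ is dense in $C_0(F)$ for the supremum norm, where $C_0(F)$ is the set of compactly supported $R$-continuous functions on $F$. Let $\mathbb F_c$ be the collection of quadruples $(F,R,\mu,\rho)$ in which $R$ is the resistance metric of a regular resistance form on $F$, $(F,R)$ is compact, $\mu$ is a finite Borel measure of full support on $(F,R)$, and $\rho\in F$. For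 $(F,R,\mu,\rho),(F',R',\mu',\rho')\in\mathbb F_c$ let $$\Delta_c=\inf_{M,\psi,\psi'}\left\{d_M^H(\psi(F),\psi'(F'))+d_M^P(\mu\circ\psi^{-1},\mu'\circ\psi'^{-1})+d_M(\psi(\rho),\psi'(\rho'))\right\},$$ the infimum being over all metric spaces $(M,d_M)$ and isometric embeddings $\psi:(F,R)\to M$, $\psi':(F',R')\to M$, where $d_M^H$ and $d_M^P$ are the Hausdorff and Prohorov distances. Convergence in $\mathbb F_c$ in the Gromov–Hausdorff-vague topology means convergence with respect to $\Delta_c$. For a fixed integer $J\ge 0$ and spaces with additional points $u_1,v_1,\dots,u_J,v_J\in F$ and $u_1',v_1',\dots,u_J',v_J'\in F'$, let $\Delta_c'$ be given by the same infimum with $\sum_{j=1}^J\left(d_M(\psi(u_j),\psi'(u_j'))+d_M(\psi(v_j),\psi'(v_j'))\right)$ added inside; convergence in the Gromov–Hausdorff-vague topology with additional points means convergence with respect to $\Delta_c'$. Given $(F,R,\mu,\rho)\in\mathbb F_c$ with form $(\mathcal E,\mathcal F)$ and points $u_1,v_1,\dots,u_J,v_J\in F$, let $\pi:F\to\tilde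 F$ be the projection onto the quotient of $F$ by the smallest equivalence relation with $u_j\sim v_j$ for every $j$ (if the sets $\{u_j,v_j\}$ are pairwise disjoint, this just turns each of them into a single point). Put $\tilde{\mathcal F}=\{f:\tilde F\to\mathbb R:\ f\circ\pi\in\mathcal F\}$, $\tilde{\mathcal E}(f,f)=\mathcal E(f\circ\pi,f\circ\pi)$, let $\tilde R$ be given by the formula in (RF4) for $(\tilde{\mathcal E},\tilde{\mathcal F})$, and put $\tilde\mu=\mu\circ\pi^{-1}$, $\tilde\rho=\pi(\rho)$. **Proposition.** Let $(F_n,R_n,\mu_n,\rho_n)$, $n\ge 1$, and $(F,R,\mu,\rho)$ be elements of $\mathbb F_c$, with points $u_1^n,v_1^n,\dots,u_J^n,v_J^n\in F_n$ and $u_1,v_1,\dots,u_J,v_J\in F$, where the $2J$ points $u_1,v_1,\dots,u_J,v_J$ are distinct. Suppose that $$(F_n,R_n,\mu_n,\rho_n,u_1^n,v_1^n,\dots,u_J^n,v_J^n)\to(F,R,\mu,\rho,u_1,v_1,\dots,u_J,v_J)$$ in the Gromov–Hausdorff-vague topology with additional points. Then the fused spaces $(\tilde F_n,\tilde R_n,\tilde\mu_n,\tilde\rho_n)$,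 $n\ge1$, and $(\tilde F,\tilde R,\tilde\mu,\tilde\rho)$ are elements of $\mathbb F_c$ (in particular, the fused forms are regular resistance forms), and $$(\tilde F_n,\tilde R_n,\tilde\mu_n,\tilde\rho_n)\to(\tilde F,\tilde R,\tilde\mu,\tilde\rho)$$ in the Gromov–Hausdorff-vague topology. -/

import Mathlib

open scoped ENNReal

universe u

noncomputable section

/-- A symmetric bilinear form `energy` (the polarisation of a quadratic form) defined on a linear
space `domain` of real functions on `F`. No axiom is imposed here. -/
structure EnergyForm (F : Type u) where
  domain : Submodule ℝ (F → ℝ)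
  energy : LinearMap.BilinForm ℝ domain

namespace EnergyForm

variable {F G : Type u}

/-- The set `{ |f x - f y|² / E(f,f) : f in the domain, E(f,f) > 0 }`. -/
def ratios (q : EnergyForm F) (x y : F) : Set ℝ :=
  {r | ∃ f : q.domain, 0 < q.energy f f ∧ r = |f.1 x - f.1 y| ^ 2 / q.energy f f}

/-- The effective resistance between two points: the supremum of `ratios` (which is bounded above
for a resistance form; on a one-point space the set is empty and the supremum is `0`). -/
def resistance (q : EnergyForm F) (x y : F) : ℝ := sSup (q.ratios x y)

/-- Resistance forms in the sense of Kigami. -/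
structure IsResistanceForm (q : EnergyForm F) : Prop where
  /-- (RF1) the domain contains the constants, -/
  const_mem : ∀ c : ℝ, (fun _ : F => c) ∈ q.domain
  /-- the form is symmetric, -/
  symm : ∀ f g : q.domain, q.energy f g = q.energy g f
  /-- nonnegative, -/
  nonneg : ∀ f : q.domain, 0 ≤ q.energy f f
  /-- and vanishes exactly on constants. -/
  eq_zero_iff : ∀ f : q.domain, q.energy f f = 0 ↔ ∃ c : ℝ, ∀ x, f.1 x = c
  /-- (RF2) the domain modulo constants, with inner product `energy`, is a Hilbert space
  (every Cauchy sequence converges). -/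
  complete : ∀ f : ℕ → q.domain,
    (∀ ε > 0, ∃ N, ∀ m ≥ N, ∀ n ≥ N, q.energy (f m - f n) (f m - f n) < ε) →
    ∃ g : q.domain,
      Filter.Tendsto (fun n => q.energy (f n - g) (f n - g)) Filter.atTop (nhds 0)
  /-- (RF3) the domain separates points. -/
  separates : ∀ x y : F, x ≠ y → ∃ f : q.domain, f.1 x ≠ f.1 y
  /-- (RF4) the resistance between any two points is finite. -/
  bddAbove : ∀ x y : F, BddAbove (q.ratios x y)
  /-- (RF5) the unit contraction operates on the form. -/
  markov : ∀ f : q.domain, ∃ h : (fun x => max (min (f.1 x) 1) 0) ∈ q.domain,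
    q.energy ⟨_, h⟩ ⟨_, h⟩ ≤ q.energy f f

/-- Regularity: the compactly supported continuous functions in the domain are dense, in the
supremum norm, in the compactly supported continuous functions. -/
def IsRegular [TopologicalSpace F] (q : EnergyForm F) : Prop :=
  ∀ g : F → ℝ, Continuous g → HasCompactSupport g → ∀ ε > 0,
    ∃ f ∈ q.domain, Continuous f ∧ HasCompactSupport f ∧ ∀ x, |f x - g x| ≤ ε

/-- The image of a form under `π : F → G`: the domain consists of the `f : G → ℝ` such that
`f ∘ π` is in the domain of `q`, and the energy of `f` is that of `f ∘ π`. -/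
def push (q : EnergyForm F) (π : F → G) : EnergyForm G where
  domain := q.domain.comap (LinearMap.funLeft ℝ ℝ π)
  energy :=
    let L : q.domain.comap (LinearMap.funLeft ℝ ℝ π) →ₗ[ℝ] q.domain :=
      (LinearMap.funLeft ℝ ℝ π).restrict (fun _ h => h)
    q.energy.compl₁₂ L L

end EnergyForm

/-- The equivalence relation on `F` that identifies any two points of the same `V j`. -/
def fuseSetoid {F : Type u} {ι : Type*} (V : ι → Set F) : Setoid F :=
  Relation.EqvGen.setoid (fun x y => ∃ j, x ∈ V j ∧ y ∈ V j)

/-- For pairwise disjoint sets the classes are the `V j` and the singletons outside their union. -/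
theorem fuseSetoid_iff {F : Type u} {ι : Type*} (V : ι → Set F)
    (hV : Pairwise (fun i j => Disjoint (V i) (V j))) (x y : F) :
    (fuseSetoid V) x y ↔ x = y ∨ ∃ j, x ∈ V j ∧ y ∈ V j := by
  constructor
  · intro h
    induction h with
    | rel x y h => exact Or.inr h
    | refl x => exact Or.inl rfl
    | symm x y _ ih =>
      rcases ih with h | ⟨j, h1, h2⟩
      · exact Or.inl h.symm
      · exact Or.inr ⟨j, h2, h1⟩
    | trans x y z _ _ ih1 ih2 =>
      rcases ih1 with rfl | ⟨j, h1, h2⟩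
      · exact ih2
      · rcases ih2 with rfl | ⟨k, h3, h4⟩
        · exact Or.inr ⟨j, h1, h2⟩
        · have hjk : j = k := by
            by_contra hne
            exact Set.disjoint_left.mp (hV hne) h2 h3
          subst hjk
          exact Or.inr ⟨j, h1, h4⟩
  · rintro (rfl | h)
    · exact Relation.EqvGen.refl _
    · exact Relation.EqvGen.rel _ _ h

/-- The data of a quadruple `(F, R, μ, ρ)`, where `R` is recorded through the form it comes from. -/
structure FormSpace where
  carrier : Type u
  form : EnergyForm carrier
  [mspace : MeasurableSpace carrier]
  μ : MeasureTheory.Measure carrier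
  ρ : carrier

attribute [instance] FormSpace.mspace

namespace FormSpace

/-- The function `R` of the quadruple `(F, R, μ, ρ)`. -/
def R (X : FormSpace.{u}) (x y : X.carrier) : ℝ := X.form.resistance x y

/-- The compact resistance spaces: the form is a regular resistance form whose resistance metric `R`
makes `F` a compact metric space, and `μ` is a finite Borel measure on `(F, R)` of full
support. (The space being compact, locally finite means finite, and recurrence is automatic as
the function `1` is continuous, compactly supported, in the domain, and has zero energy.) -/
def IsCompactResistanceSpace (X : FormSpace.{u}) : Prop :=
  X.form.IsResistanceForm ∧
  ∃ _ : MetricSpace X.carrier,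
    (∀ x y : X.carrier, dist x y = X.R x y) ∧
    CompactSpace X.carrier ∧
    X.form.IsRegular ∧
    BorelSpace X.carrier ∧
    MeasureTheory.IsFiniteMeasure X.μ ∧
    X.μ.IsOpenPosMeasure

/-- The space obtained by fusing each `V j` to one point. With `π` the projection onto the
quotient, the form is the image of the form under `π`, the measure is `μ ∘ π⁻¹` (on the sets with
measurable preimage), and the root is `π ρ`. -/
def fuse (X : FormSpace.{u}) {ι : Type*} (V : ι → Set X.carrier) : FormSpace.{u} where
  carrier := Quotient (fuseSetoid V)
  form := X.form.push (Quotient.mk (fuseSetoid V))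
  μ := X.μ.map (Quotient.mk (fuseSetoid V))
  ρ := Quotient.mk (fuseSetoid V) X.ρ

/-- Isometric embeddings of `(F, R)` and `(F', R')` into a common metric space. -/
structure CommonEmbedding (X Y : FormSpace.{u}) where
  M : Type u
  [metric : MetricSpace M]
  left : X.carrier → M
  right : Y.carrier → M
  left_isom : ∀ x y, dist (left x) (left y) = X.R x y
  right_isom : ∀ x y, dist (right x) (right y) = Y.R x y

attribute [instance] CommonEmbedding.metric

namespace CommonEmbedding

variable {X Y : FormSpace.{u}}

/-- The Prohorov distance of the image measures, as Borel measures on `M`. -/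
def prohorov (e : CommonEmbedding X Y) : ℝ≥0∞ :=
  letI : MeasurableSpace e.M := borel e.M
  MeasureTheory.levyProkhorovEDist (X.μ.map e.left) (Y.μ.map e.right)

/-- Hausdorff distance of the images, plus Prohorov distance of the image measures, plus distance
of the images of the roots. -/
def cost (e : CommonEmbedding X Y) : ℝ≥0∞ :=
  Metric.hausdorffEDist (Set.range e.left) (Set.range e.right) + e.prohorov +
    edist (e.left X.ρ) (e.right Y.ρ)

end CommonEmbedding

/-- The distance that induces the Gromov–Hausdorff-vague topology on compact spaces. -/
def ghvDist (X Y : FormSpace.{u}) : ℝ≥0∞ := ⨅ e : CommonEmbedding X Y, e.cost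

/-- The distance that induces the Gromov–Hausdorff-vague topology with additional points
`u₁, v₁, …, u_J, v_J`. -/
def markedGhvDist {J : ℕ} (X : FormSpace.{u}) (u v : Fin J → X.carrier)
    (Y : FormSpace.{u}) (u' v' : Fin J → Y.carrier) : ℝ≥0∞ :=
  ⨅ e : CommonEmbedding X Y,
    e.cost + ∑ j, (edist (e.left (u j)) (e.right (u' j)) + edist (e.left (v j)) (e.right (v' j)))

/-- Fusing the pairs `{u j, v j}`. -/
def fusePairs {J : ℕ} (X : FormSpace.{u}) (u v : Fin J → X.carrier) : FormSpace.{u} :=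
  X.fuse (fun j => {u j, v j})

end FormSpace

end

/-! Modulo constants, the domain of a resistance form is a Hilbert space, and `f ↦ f x - f y` is
represented by a vector `dipole x y` whose squared norm is the resistance. By polarisation, all
inner products of dipoles are linear expressions in resistances (`energy_dipole_dipole`).

Fusing restricts the form to functions with `f (u j) = f (v j)`, that is, to the orthogonal
complement of the dipoles `dipole (u j) (v j)`. So the fused resistance of `x` and `y` is the
squared distance from `dipole x y` to the span of these dipoles: a minimum over `a : Fin J → ℝ` of a
quadratic polynomial `fusedEnergy` whose coefficients are resistances (`resistance_fuse_le`,
`exists_resistance_fuse_eq`). If two spaces are in correspondence with small distortion, their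
polynomials are close; the minimisers stay bounded because the limit points are distinct, so that
the limit dipoles are independent (`exists_sq_sum_le_spanEnergy`). Hence the fused resistances are
uniformly close (`abs_resistance_fuse_sub_le`).

A nearly optimal common embedding gives such a correspondence. It descends to the quotients, which
are then glued along it, and this controls the Hausdorff, Prohorov and root terms together
(`ghvDist_le_of_quotient`). That fused spaces are again compact resistance spaces rests on finite
interpolation for separation and on the lattice form of Stone–Weierstrass for regularity. -/

noncomputable section

/-! ### Hilbert space of a complete nonnegative form -/

namespace LinearMap.BilinForm

variable {E : Type u} [AddCommGroup E] [Module ℝ E] (B : LinearMap.BilinForm ℝ E)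

/-- A nonnegative symmetric bilinear form as a semi-inner product. -/
@[reducible]
def semiInnerCore (hs : ∀ f g, B f g = B g f) (hn : ∀ f, 0 ≤ B f f) :
    PreInnerProductSpace.Core ℝ E where
  inner f g := B f g
  conj_inner_symm f g := hs g f
  re_inner_nonneg f := hn f
  add_left f g k := by simp
  smul_left f g r := by simp

/-- The quotient of a complete semi-inner product space by its null space is a Hilbert space, on
which bounded functionals are represented by vectors. -/
theorem exists_hilbert_quotient (hs : ∀ f g, B f g = B g f) (hn : ∀ f, 0 ≤ B f f)
    (hc : ∀ f : ℕ → E, (∀ ε > 0, ∃ N, ∀ m ≥ N, ∀ n ≥ N, B (f m - f n) (f m - f n) < ε) →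
      ∃ g, Filter.Tendsto (fun n => B (f n - g) (f n - g)) Filter.atTop (nhds 0)) :
    ∃ (H : Type u) (_ : NormedAddCommGroup H) (_ : InnerProductSpace ℝ H) (_ : CompleteSpace H)
      (T : E →ₗ[ℝ] H), Function.Surjective T ∧ (∀ f g, inner ℝ (T f) (T g) = B f g) ∧
        ∀ (δ : E →ₗ[ℝ] ℝ) (C : ℝ), (∀ f, δ f ^ 2 ≤ C * B f f) →
          ∃ φ : H, ∀ f, inner ℝ φ (T f) = δ f := by
  let _ : SeminormedAddCommGroup E :=
    @InnerProductSpace.Core.toSeminormedAddCommGroup ℝ _ _ _ _ (B.semiInnerCore hs hn)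
  let _ : InnerProductSpace ℝ E := InnerProductSpace.ofCore (B.semiInnerCore hs hn)
  have hnorm : ∀ f : E, ‖f‖ ^ 2 = B f f := fun f => (real_inner_self_eq_norm_sq f).symm
  have : CompleteSpace E := by
    refine Metric.complete_of_cauchySeq_tendsto fun f hf => ?_
    rw [Metric.cauchySeq_iff] at hf
    obtain ⟨g, hg⟩ := hc f fun ε hε => by
      obtain ⟨N, hN⟩ := hf (√ε) (Real.sqrt_pos.2 hε)
      refine ⟨N, fun m hm n hn' => ?_⟩
      have := hN m hm n hn'
      rw [dist_eq_norm, Real.lt_sqrt (norm_nonneg _), hnorm] at this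
      exact this
    refine ⟨g, ?_⟩
    rw [tendsto_iff_norm_sub_tendsto_zero]
    have h2 := hg.sqrt
    simp only [← hnorm, Real.sqrt_sq (norm_nonneg _), Real.sqrt_zero] at h2
    exact h2
  refine ⟨SeparationQuotient E, inferInstance, inferInstance, inferInstance,
    (SeparationQuotient.mkCLM ℝ E).toLinearMap, SeparationQuotient.surjective_mk,
    fun f g => rfl, fun δ C hC => ?_⟩
  have hδ : ∀ f, ‖δ f‖ ≤ √C * ‖f‖ := fun f => by
    rw [Real.norm_eq_abs, ← Real.sqrt_sq (norm_nonneg f), ← Real.sqrt_mul' _ (sq_nonneg _),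
      ← Real.sqrt_sq_eq_abs, hnorm]
    exact Real.sqrt_le_sqrt (hC f)
  let δ' : E →L[ℝ] ℝ := δ.mkContinuous _ hδ
  -- A bounded functional is constant on inseparable points, so it descends to the separation
  -- quotient, where Riesz representation applies.
  have hins : ∀ f g : E, Inseparable f g → δ' f = δ' g := fun f g hfg =>
    (hfg.map δ'.continuous).eq
  refine ⟨(InnerProductSpace.toDual ℝ _).symm (SeparationQuotient.liftCLM δ' hins), fun f => ?_⟩
  rw [InnerProductSpace.toDual_symm_apply]
  rfl

end LinearMap.BilinForm

/-! ### Dipoles, the resistance metric, interpolation and regularity -/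

namespace EnergyForm

namespace IsResistanceForm

variable {F : Type u} {q : EnergyForm F}

theorem energy_sub_self (h : q.IsResistanceForm) (f g : q.domain) :
    q.energy (f - g) (f - g) = q.energy f f - 2 * q.energy f g + q.energy g g := by
  simp only [map_sub, LinearMap.sub_apply, h.symm g f]; ring

theorem cauchySchwarz (h : q.IsResistanceForm) (f g : q.domain) :
    q.energy f g ^ 2 ≤ q.energy f f * q.energy g g := by
  let _ := q.energy.semiInnerCore h.symm h.nonneg
  have := InnerProductSpace.Core.inner_mul_inner_self_le (𝕜 := ℝ) f g
  have h1 : ‖q.energy f g‖ * ‖q.energy g f‖ ≤ q.energy f f * q.energy g g := this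
  rw [h.symm g f, ← sq, Real.norm_eq_abs, sq_abs] at h1
  exact h1

theorem apply_eq_of_energy_eq_zero (h : q.IsResistanceForm) {f : q.domain}
    (hf : q.energy f f = 0) (x y : F) : f.1 x = f.1 y := by
  obtain ⟨c, hc⟩ := (h.eq_zero_iff f).1 hf
  rw [hc, hc]

theorem resistance_nonneg (q : EnergyForm F) (x y : F) : 0 ≤ q.resistance x y := by
  refine Real.sSup_nonneg ?_
  rintro _ ⟨f, hf, rfl⟩
  positivity

theorem resistance_comm (q : EnergyForm F) (x y : F) : q.resistance x y = q.resistance y x := by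
  simp only [resistance, ratios, abs_sub_comm]

theorem resistance_self (q : EnergyForm F) (x : F) : q.resistance x x = 0 := by
  refine le_antisymm (Real.sSup_nonpos ?_) (resistance_nonneg q x x)
  rintro _ ⟨f, hf, rfl⟩
  simp

theorem sq_sub_le (h : q.IsResistanceForm) (f : q.domain) (x y : F) :
    (f.1 x - f.1 y) ^ 2 ≤ q.resistance x y * q.energy f f := by
  rcases (h.nonneg f).eq_or_lt with h0 | h0
  · rw [h.apply_eq_of_energy_eq_zero h0.symm x y, ← h0]; simp
  · have := le_csSup (h.bddAbove x y) ⟨f, h0, rfl⟩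
    rwa [div_le_iff₀ h0, sq_abs] at this

/-- The domain modulo constants is a Hilbert space. -/
theorem exists_hilbert (h : q.IsResistanceForm) :
    ∃ (H : Type u) (_ : NormedAddCommGroup H) (_ : InnerProductSpace ℝ H) (_ : CompleteSpace H)
      (T : q.domain →ₗ[ℝ] H), Function.Surjective T ∧ (∀ f g, inner ℝ (T f) (T g) = q.energy f g) ∧
        ∀ x y, ∃ φ : H, ∀ f, inner ℝ φ (T f) = f.1 x - f.1 y := by
  obtain ⟨H, i1, i2, i3, T, hT, hE, hφ⟩ :=
    q.energy.exists_hilbert_quotient h.symm h.nonneg h.complete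
  refine ⟨H, i1, i2, i3, T, hT, hE, fun x y => ?_⟩
  exact hφ
    { toFun := fun f => f.1 x - f.1 y
      map_add' := fun f g => by simp; ring
      map_smul' := fun c f => by simp; ring } (q.resistance x y) (h.sq_sub_le · x y)

theorem exists_representer (h : q.IsResistanceForm) (x y : F) :
    ∃ φ : q.domain, ∀ f, q.energy φ f = f.1 x - f.1 y := by
  obtain ⟨H, _, _, _, T, hT, hE, hφ⟩ := h.exists_hilbert
  obtain ⟨φ, hφ⟩ := hφ x y
  obtain ⟨ψ, rfl⟩ := hT φ
  exact ⟨ψ, fun f => by rw [← hE, hφ]⟩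

/-- The element of the domain that represents `f ↦ f x - f y`. -/
def dipole (h : q.IsResistanceForm) (x y : F) : q.domain := (h.exists_representer x y).choose

theorem energy_dipole (h : q.IsResistanceForm) (x y : F) (f : q.domain) :
    q.energy (h.dipole x y) f = f.1 x - f.1 y := (h.exists_representer x y).choose_spec f

theorem energy_dipole_right (h : q.IsResistanceForm) (x y : F) (f : q.domain) :
    q.energy f (h.dipole x y) = f.1 x - f.1 y := by rw [h.symm, h.energy_dipole]

/-- Cauchy–Schwarz against the representer bounds every ratio, and the representer itself attains
the bound unless its energy is zero. -/
theorem energy_dipole_self (h : q.IsResistanceForm) (x y : F) :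
    q.energy (h.dipole x y) (h.dipole x y) = q.resistance x y := by
  set φ := h.dipole x y
  apply le_antisymm
  · rcases (h.nonneg φ).eq_or_lt with h0 | h0
    · rw [← h0]; exact resistance_nonneg q x y
    · have := h.sq_sub_le φ x y
      rw [← h.energy_dipole, sq] at this
      exact le_of_mul_le_mul_right this h0
  · refine Real.sSup_le ?_ (h.nonneg φ)
    rintro _ ⟨f, hf, rfl⟩
    rw [div_le_iff₀ hf, sq_abs, ← h.energy_dipole]
    exact h.cauchySchwarz φ f

/-- The energy of a pair of dipoles, in terms of resistances. -/
theorem energy_dipole_dipole (h : q.IsResistanceForm) (x y z w : F) :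
    q.energy (h.dipole x y) (h.dipole z w) =
      (q.resistance x w + q.resistance y z - q.resistance x z - q.resistance y w) / 2 := by
  have key : ∀ a b, q.resistance a b = q.energy (h.dipole a x) (h.dipole a x)
      - 2 * q.energy (h.dipole a x) (h.dipole b x) + q.energy (h.dipole b x) (h.dipole b x) := by
    -- Only modulo constants is a dipole the difference of two dipoles with common base point `x`;
    -- the energy does not see the constant.
    intro a b
    have e : ∀ f, q.energy (h.dipole a b) f = q.energy (h.dipole a x - h.dipole b x) f := by
      intro f
      simp only [map_sub, LinearMap.sub_apply, h.energy_dipole]; ring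
    rw [← h.energy_sub_self, ← h.energy_dipole_self, e, h.symm, e]
  have e2 : q.energy (h.dipole x y) (h.dipole z w) =
      q.energy (h.dipole x x) (h.dipole z x) - q.energy (h.dipole x x) (h.dipole w x)
      - q.energy (h.dipole y x) (h.dipole z x) + q.energy (h.dipole y x) (h.dipole w x) := by
    rw [h.energy_dipole_right]
    have e3 : ∀ f, q.energy (h.dipole x y) f = q.energy (h.dipole x x - h.dipole y x) f := by
      intro f
      simp only [map_sub, LinearMap.sub_apply, h.energy_dipole]; ring
    rw [← h.energy_dipole_right, e3, h.energy_dipole_right]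
    simp only [h.energy_dipole_right, Submodule.coe_sub, Pi.sub_apply]
    ring
  rw [e2, key x w, key y z, key x z, key y w]
  ring

theorem energy_one_left (h : q.IsResistanceForm) (c : ℝ) (f : q.domain) :
    q.energy ⟨fun _ => c, h.const_mem c⟩ f = 0 := by
  have h0 := (h.eq_zero_iff ⟨fun _ => c, h.const_mem c⟩).2 ⟨c, fun _ => rfl⟩
  have := h.cauchySchwarz ⟨fun _ => c, h.const_mem c⟩ f
  rw [h0, zero_mul] at this
  exact pow_eq_zero_iff (two_ne_zero) |>.1 (le_antisymm this (sq_nonneg _))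

/-- The maximum principle: a dipole lies between its values at its poles. -/
theorem dipole_mem_Icc (h : q.IsResistanceForm) (x z y : F) :
    (h.dipole x z).1 z ≤ (h.dipole x z).1 y ∧ (h.dipole x z).1 y ≤ (h.dipole x z).1 x := by
  set φ := h.dipole x z with hφ
  have hR : φ.1 x - φ.1 z = q.energy φ φ := (h.energy_dipole x z φ).symm
  rcases (h.nonneg φ).eq_or_lt with h0 | h0
  · rw [h.apply_eq_of_energy_eq_zero h0.symm y z, h.apply_eq_of_energy_eq_zero h0.symm x z]
    exact ⟨le_rfl, le_rfl⟩
  set r := q.energy φ φ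
  set f : q.domain := r⁻¹ • (φ - ⟨fun _ => φ.1 z, h.const_mem _⟩) with hf
  have fval : ∀ w, f.1 w = (φ.1 w - φ.1 z) / r := fun w => by
    simp [hf, div_eq_inv_mul]
  have fE : ∀ k, q.energy f k = r⁻¹ * (k.1 x - k.1 z) := fun k => by
    simp only [hf, map_smul, map_sub, LinearMap.sub_apply, LinearMap.smul_apply, smul_eq_mul,
      h.energy_one_left, sub_zero]
    rw [h.energy_dipole]
  have fx : f.1 x = 1 := by rw [fval, hR, div_self h0.ne']
  have fz : f.1 z = 0 := by rw [fval, sub_self, zero_div]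
  obtain ⟨hg, hgE⟩ := h.markov f
  set g : q.domain := ⟨_, hg⟩
  have gx : g.1 x = 1 := by simp [g, fx]
  have gz : g.1 z = 0 := by simp [g, fz]
  -- Pairing with the normalised potential `f` depends only on the values at `x` and `z`, where `f`
  -- and its clipping `g` agree. Hence the energy of `f - g` is that of `g` minus that of `f`, which
  -- is nonpositive by the Markov property.
  have hfg : q.energy (f - g) (f - g) = 0 := by
    refine le_antisymm ?_ (h.nonneg _)
    rw [h.energy_sub_self, fE g, fE f] at *
    rw [fx, fz] at *
    rw [gx, gz]
    linarith
  have hy := h.apply_eq_of_energy_eq_zero hfg y z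
  simp only [Submodule.coe_sub, Pi.sub_apply, gz, fz, sub_zero] at hy
  have hy' : f.1 y = max (min (f.1 y) 1) 0 := by linarith
  have h1 : 0 ≤ f.1 y := by rw [hy']; exact le_max_right _ _
  have h2 : f.1 y ≤ 1 := by rw [hy']; exact max_le (min_le_right _ _) zero_le_one
  rw [fval] at h1 h2
  rw [div_le_one h0] at h2
  have h3 := (div_nonneg_iff.1 h1).resolve_right (fun h' => by linarith [h'.2])
  constructor <;> linarith [h3.1]

/-- The Hilbert norm alone would give this only for the square root of the resistance. The maximum
principle does better: the pairing of `dipole x y` with `dipole x z` is a drop of potential between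
`x` and `z`, at most the full drop between the poles; likewise for `dipole y z`. -/
theorem resistance_triangle (h : q.IsResistanceForm) (x y z : F) :
    q.resistance x z ≤ q.resistance x y + q.resistance y z := by
  have e : q.energy (h.dipole x z) (h.dipole x z) =
      q.energy (h.dipole x y) (h.dipole x z) + q.energy (h.dipole y z) (h.dipole x z) := by
    simp only [h.energy_dipole]; ring
  rw [← h.energy_dipole_self x z, ← h.energy_dipole_self x y, ← h.energy_dipole_self y z, e]
  simp only [h.energy_dipole_right]
  have h1 := h.dipole_mem_Icc x y z
  have h2 := h.dipole_mem_Icc y z x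
  linarith [h1.1, h2.2]

theorem eq_of_resistance_eq_zero (h : q.IsResistanceForm) {x y : F}
    (h0 : q.resistance x y = 0) : x = y := by
  by_contra hne
  obtain ⟨f, hf⟩ := h.separates x y hne
  have := h.sq_sub_le f x y
  rw [h0, zero_mul] at this
  exact hf (sub_eq_zero.1 (pow_eq_zero_iff (two_ne_zero) |>.1 (le_antisymm this (sq_nonneg _))))

/-- The resistance metric. -/
@[reducible]
def metricSpace (h : q.IsResistanceForm) : MetricSpace F where
  dist := q.resistance
  dist_self := resistance_self q
  dist_comm := resistance_comm q
  dist_triangle := h.resistance_triangle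
  eq_of_dist_eq_zero := h.eq_of_resistance_eq_zero

/-- Orthogonal projection onto the span of finitely many elements of the domain. -/
theorem exists_projection (h : q.IsResistanceForm) {ι : Type*} [Fintype ι] (g : ι → q.domain)
    (ψ : q.domain) : ∃ a : ι → ℝ, ∀ i, q.energy (g i) (ψ - ∑ j, a j • g j) = 0 := by
  obtain ⟨H, _, _, _, T, hT, hE, -⟩ := h.exists_hilbert
  let K : Submodule ℝ H := Submodule.span ℝ (Set.range fun i => T (g i))
  have : FiniteDimensional ℝ K := FiniteDimensional.span_of_finite ℝ (Set.finite_range _)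
  obtain ⟨a, ha⟩ := (Submodule.mem_span_range_iff_exists_fun ℝ).1
    (K.starProjection_apply_mem (T ψ))
  refine ⟨a, fun i => ?_⟩
  have h1 : T (g i) ∈ K := Submodule.subset_span ⟨i, rfl⟩
  have h2 := K.sub_starProjection_mem_orthogonal (T ψ)
  have h3 := (Submodule.mem_orthogonal K _).1 h2 _ h1
  rw [← hE]
  simpa [ha] using h3

/-- Functions on a finite set extend to the domain: indicator of a point. -/
theorem exists_indicator (h : q.IsResistanceForm) (x : F) (V : Finset F) :
    ∃ f : q.domain, f.1 x = 1 ∧ (∀ y ∈ V, y ≠ x → f.1 y = 0) ∧ ∀ y, f.1 y ∈ Set.Icc (0 : ℝ) 1 := by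
  classical
  have clip : ∀ f : q.domain, ∃ g : q.domain, ∀ y, g.1 y = max (min (f.1 y) 1) 0 := fun f =>
    ⟨⟨_, (h.markov f).1⟩, fun _ => rfl⟩
  induction V using Finset.induction_on with
  | empty => exact ⟨⟨fun _ => 1, h.const_mem 1⟩, rfl, by simp, by simp⟩
  | insert z V hz ih =>
    obtain ⟨f, fx, fV, fI⟩ := ih
    by_cases hzx : z = x
    · subst hzx
      refine ⟨f, fx, fun y hy hne => fV y ((Finset.mem_insert.1 hy).resolve_left hne) hne, fI⟩
    obtain ⟨k, hk⟩ := h.separates x z (Ne.symm hzx)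
    obtain ⟨g, hg⟩ := clip ((k.1 x - k.1 z)⁻¹ • (k - ⟨fun _ => k.1 z, h.const_mem _⟩))
    have hk' : k.1 x - k.1 z ≠ 0 := sub_ne_zero.2 hk
    have gx : g.1 x = 1 := by rw [hg]; simp [hk']
    have gz : g.1 z = 0 := by rw [hg]; simp
    have gI : ∀ y, g.1 y ∈ Set.Icc (0 : ℝ) 1 := fun y => by
      rw [hg]; exact ⟨le_max_right _ _, max_le (min_le_right _ _) zero_le_one⟩
    -- Clipping `f + g - 1` plays the role of a product: for values in `[0, 1]` it is `1` where both
    -- are `1` and `0` where either vanishes.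
    obtain ⟨e, he⟩ := clip (f + g - ⟨fun _ => 1, h.const_mem 1⟩)
    simp only [Submodule.coe_sub, Submodule.coe_add, Pi.sub_apply, Pi.add_apply] at he
    refine ⟨e, by rw [he, fx, gx]; norm_num, fun y hy hne => ?_, fun y => ?_⟩
    · rw [he]
      rcases Finset.mem_insert.1 hy with rfl | hy
      · rw [gz]; refine max_eq_right ((min_le_left _ _).trans ?_); linarith [(fI y).2]
      · rw [fV y hy hne]; refine max_eq_right ((min_le_left _ _).trans ?_); linarith [(gI y).2]
    · rw [he]; exact ⟨le_max_right _ _, max_le (min_le_right _ _) zero_le_one⟩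

/-- Every function on a finite set is the restriction of an element of the domain. -/
theorem exists_extension (h : q.IsResistanceForm) (V : Finset F) (g : F → ℝ) :
    ∃ f : q.domain, ∀ y ∈ V, f.1 y = g y := by
  choose e e1 e0 _ using fun x => h.exists_indicator x V
  refine ⟨∑ x ∈ V, g x • e x, fun y hy => ?_⟩
  have : (∑ x ∈ V, g x • e x : q.domain).1 y = ∑ x ∈ V, g x * (e x).1 y := by
    simp
  rw [this, Finset.sum_eq_single_of_mem y hy, e1, mul_one]
  intro x _ hx
  rw [e0 x y hy hx.symm, mul_zero]

/-- A form on a compact space is regular. -/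
theorem isRegular (h : q.IsResistanceForm) [MetricSpace F] [CompactSpace F]
    (hd : ∀ x y : F, dist x y = q.resistance x y) : q.IsRegular := by
  classical
  have cont : ∀ f : q.domain, Continuous f.1 := fun f => by
    have hb : ∀ x y, dist (f.1 x) (f.1 y) ≤ √(dist x y * q.energy f f) := fun x y => by
      rw [Real.dist_eq, ← Real.sqrt_sq_eq_abs, hd]
      exact Real.sqrt_le_sqrt (h.sq_sub_le f x y)
    refine continuous_iff_continuousAt.2 fun x => ?_
    refine tendsto_iff_dist_tendsto_zero.2 (squeeze_zero (fun _ => dist_nonneg) (fun y => hb y x) ?_)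
    have : Continuous fun y => √(dist y x * q.energy f f) := by fun_prop
    simpa using this.tendsto x
  -- By compactness `f` is bounded above; after scaling it below `1`, the upper cut of the unit
  -- contraction does nothing and only the positive part remains.
  have pos : ∀ f : q.domain, (fun x => max (f.1 x) 0) ∈ q.domain := fun f => by
    obtain ⟨C, hC⟩ := (isCompact_range (cont f)).bddAbove
    have hC' : ∀ x, f.1 x ≤ max C 1 := fun x => (hC ⟨x, rfl⟩).trans (le_max_left _ _)
    have hpos : 0 < max C 1 := lt_of_lt_of_le one_pos (le_max_right _ _)
    have := q.domain.smul_mem (max C 1) (h.markov ((max C 1)⁻¹ • f)).1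
    convert this using 1
    ext x
    simp only [Submodule.coe_smul, Pi.smul_apply, smul_eq_mul]
    rw [min_eq_left, mul_max_of_nonneg _ _ hpos.le, mul_inv_cancel_left₀ hpos.ne', mul_zero]
    rw [inv_mul_le_iff₀ hpos, mul_one]
    exact hC' x
  have sup : ∀ f g : F → ℝ, f ∈ q.domain → g ∈ q.domain → (fun x => max (f x) (g x)) ∈ q.domain := by
    intro f g hf hg
    have := q.domain.add_mem (pos (⟨f, hf⟩ - ⟨g, hg⟩)) hg
    convert this using 1
    ext x
    simp [max_add]
  have inf : ∀ f g : F → ℝ, f ∈ q.domain → g ∈ q.domain → (fun x => min (f x) (g x)) ∈ q.domain := by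
    intro f g hf hg
    have := q.domain.neg_mem (sup _ _ (q.domain.neg_mem hf) (q.domain.neg_mem hg))
    convert this using 1
    ext x
    simp [max_neg_neg]
  let L : Set C(F, ℝ) := {f | (f : F → ℝ) ∈ q.domain}
  have hL : closure L = ⊤ := by
    refine ContinuousMap.sublattice_closure_eq_top L ⟨0, q.domain.zero_mem⟩
      (fun f hf g hg => inf f g hf hg) (fun f hf g hg => sup f g hf hg) ?_
    intro v x y
    obtain ⟨f, hf⟩ := h.exists_extension {x, y} v
    exact ⟨⟨f.1, cont f⟩, f.2, hf x (by simp), hf y (by simp)⟩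
  intro g hg _ ε hε
  have hmem : (⟨g, hg⟩ : C(F, ℝ)) ∈ closure L := by rw [hL]; trivial
  obtain ⟨f, hf, hfg⟩ := Metric.mem_closure_iff.1 hmem ε hε
  refine ⟨f, hf, f.continuous, HasCompactSupport.of_compactSpace _, fun x => ?_⟩
  have := (ContinuousMap.dist_apply_le_dist x).trans hfg.le
  rw [dist_comm, Real.dist_eq] at this
  exact this

end IsResistanceForm

end EnergyForm

end

noncomputable section

/-! ### Image forms and the dual variational formula for fused resistance -/

namespace EnergyForm

variable {F G : Type u} {q : EnergyForm F}

/-- The polarisation of a resistance function. -/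
def crossResistance (r : F → F → ℝ) (x y z w : F) : ℝ := (r x w + r y z - r x z - r y w) / 2

/-- The energy of a combination of dipoles, as a function of resistances. -/
def spanEnergy (r : F → F → ℝ) {J : ℕ} (u v : Fin J → F) (a : Fin J → ℝ) : ℝ :=
  ∑ i, ∑ j, a i * (a j * crossResistance r (u i) (v i) (u j) (v j))

/-- The energy of the difference of a dipole and a combination of dipoles, as a function of
resistances. -/
def fusedEnergy (r : F → F → ℝ) {J : ℕ} (u v : Fin J → F) (x y : F) (a : Fin J → ℝ) : ℝ :=
  r x y - 2 * ∑ j, a j * crossResistance r x y (u j) (v j) + spanEnergy r u v a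

/-- The element of the domain of the image form under `π` given by a function that factors. -/
theorem exists_push_domain {π : F → G} (hπ : Function.Surjective π) (f : q.domain)
    (hf : ∀ x y, π x = π y → f.1 x = f.1 y) : ∃ g : (q.push π).domain, g.1 ∘ π = f.1 := by
  have hfac : (f.1 ∘ Function.surjInv hπ) ∘ π = f.1 := by
    ext x
    exact hf _ _ (Function.surjInv_eq hπ (π x))
  exact ⟨⟨f.1 ∘ Function.surjInv hπ, show (f.1 ∘ Function.surjInv hπ) ∘ π ∈ q.domain by
    rw [hfac]; exact f.2⟩, hfac⟩

/-- The pull-back of an element of the domain of the image form. -/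
def pull (π : F → G) (g : (q.push π).domain) : q.domain := ⟨g.1 ∘ π, g.2⟩

theorem push_energy (π : F → G) (f g : (q.push π).domain) :
    (q.push π).energy f g = q.energy (pull π f) (pull π g) := rfl

namespace IsResistanceForm

theorem energy_sum_dipole (h : q.IsResistanceForm) {J : ℕ} (u v : Fin J → F) (a : Fin J → ℝ) :
    q.energy (∑ j, a j • h.dipole (u j) (v j)) (∑ j, a j • h.dipole (u j) (v j)) =
      spanEnergy q.resistance u v a := by
  simp only [map_sum, LinearMap.sum_apply, map_smul, LinearMap.smul_apply, smul_eq_mul,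
    h.energy_dipole_dipole, spanEnergy, crossResistance, Finset.mul_sum]
  rw [Finset.sum_comm]
  refine Finset.sum_congr rfl fun i _ => Finset.sum_congr rfl fun j _ => ?_
  ring

theorem energy_dipole_sub_sum (h : q.IsResistanceForm) {J : ℕ} (u v : Fin J → F) (x y : F)
    (a : Fin J → ℝ) :
    q.energy (h.dipole x y - ∑ j, a j • h.dipole (u j) (v j))
      (h.dipole x y - ∑ j, a j • h.dipole (u j) (v j)) =
        fusedEnergy q.resistance u v x y a := by
  rw [h.energy_sub_self, h.energy_sum_dipole, h.energy_dipole_self, fusedEnergy]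
  simp only [map_sum, map_smul, smul_eq_mul, h.energy_dipole_dipole, crossResistance]

/-- Pulling back transfers each axiom except separation of points, which can fail for a general
quotient and is therefore assumed. -/
theorem push (h : q.IsResistanceForm) {π : F → G} (hπ : Function.Surjective π)
    (hsep : ∀ x y, π x ≠ π y → ∃ f : (q.push π).domain, f.1 (π x) ≠ f.1 (π y)) :
    (q.push π).IsResistanceForm where
  const_mem c := h.const_mem c
  symm f g := h.symm _ _
  nonneg f := h.nonneg _
  eq_zero_iff f := by
    rw [push_energy, h.eq_zero_iff]
    exact exists_congr fun c => ⟨fun H => hπ.forall.2 H, fun H x => H (π x)⟩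
  complete f hf := by
    obtain ⟨g, hg⟩ := h.complete (fun n => pull π (f n)) hf
    -- Differences of values are continuous in the energy, so the limit inherits constancy on the
    -- fibres of `π`.
    obtain ⟨k, hk⟩ := exists_push_domain hπ g fun x y hxy => by
      have h1 : ∀ n, (g.1 x - g.1 y) ^ 2 ≤
          q.resistance x y * q.energy (pull π (f n) - g) (pull π (f n) - g) := fun n => by
        have h2 := h.sq_sub_le (pull π (f n) - g) x y
        have h3 : (pull π (f n)).1 x = (pull π (f n)).1 y := congrArg (f n).1 hxy
        simp only [Submodule.coe_sub, Pi.sub_apply, h3] at h2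
        linarith
      have h4 := ge_of_tendsto (hg.const_mul (q.resistance x y)) (Filter.Eventually.of_forall h1)
      rw [mul_zero] at h4
      exact sub_eq_zero.1 (pow_eq_zero_iff (two_ne_zero) |>.1 (le_antisymm h4 (sq_nonneg _)))
    refine ⟨k, ?_⟩
    have : pull π k = g := Subtype.ext hk
    rw [← this] at hg
    exact hg
  separates x y hxy := by
    obtain ⟨x, rfl⟩ := hπ x
    obtain ⟨y, rfl⟩ := hπ y
    exact hsep x y hxy
  bddAbove x y := by
    obtain ⟨x, rfl⟩ := hπ x
    obtain ⟨y, rfl⟩ := hπ y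
    refine (h.bddAbove x y).mono ?_
    rintro _ ⟨f, hf, rfl⟩
    exact ⟨pull π f, hf, rfl⟩
  markov f := h.markov (pull π f)

/-- The supremum runs over fewer test functions. This makes the projection `1`-Lipschitz. -/
theorem resistance_push_le (h : q.IsResistanceForm) (π : F → G) (x y : F) :
    (q.push π).resistance (π x) (π y) ≤ q.resistance x y := by
  refine Real.sSup_le ?_ (resistance_nonneg q x y)
  rintro _ ⟨f, hf, rfl⟩
  exact le_csSup (h.bddAbove x y) ⟨pull π f, hf, rfl⟩

end IsResistanceForm

end EnergyForm

theorem fuseSetoid_mk_left_eq_right {F : Type u} {J : ℕ} (u v : Fin J → F) (j : Fin J) :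
    Quotient.mk (fuseSetoid fun j => ({u j, v j} : Set F)) (u j) = Quotient.mk _ (v j) :=
  Quotient.sound (Relation.EqvGen.rel _ _ ⟨j, by simp, by simp⟩)

/-- A function that takes equal values at each pair of fused points factors. -/
theorem eq_of_fuseSetoid {F : Type u} {J : ℕ} (u v : Fin J → F) {α : Type*} {f : F → α}
    (hf : ∀ j, f (u j) = f (v j)) (x y : F)
    (hxy : Quotient.mk (fuseSetoid fun j => ({u j, v j} : Set F)) x = Quotient.mk _ y) :
    f x = f y := by
  have := Quotient.exact hxy
  change Relation.EqvGen _ x y at this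
  induction this with
  | rel x y h =>
    obtain ⟨j, hx, hy⟩ := h
    rcases hx with rfl | rfl <;> rcases hy with rfl | rfl <;> simp [hf]
  | refl => rfl
  | symm x y _ ih => exact (ih hxy.symm).symm
  | trans x y z h1 h2 ih1 ih2 => exact (ih1 (Quotient.sound h1)).trans (ih2 (Quotient.sound h2))

namespace EnergyForm.IsResistanceForm

variable {F : Type u} {q : EnergyForm F}

/-- Two classes are separated by interpolating the indicator of one of them at the finitely many
points `x`, `y`, `u j`, `v j`; agreement at the fused points is enough to descend. -/
theorem fuse (h : q.IsResistanceForm) {J : ℕ} (u v : Fin J → F) :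
    (q.push (Quotient.mk (fuseSetoid fun j => {u j, v j}))).IsResistanceForm := by
  classical
  refine h.push Quotient.mk_surjective fun x y hxy => ?_
  set π : F → _ := Quotient.mk (fuseSetoid fun j => {u j, v j})
  obtain ⟨f, hf⟩ := h.exists_extension ({x, y} ∪ (Finset.univ.image u ∪ Finset.univ.image v))
    (fun z => if π z = π x then 1 else 0)
  obtain ⟨g, hg⟩ := exists_push_domain Quotient.mk_surjective f <|
    eq_of_fuseSetoid u v fun j => by
      rw [hf _ (by simp), hf _ (by simp),
        show π (u j) = π (v j) from fuseSetoid_mk_left_eq_right u v j]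
  refine ⟨g, ?_⟩
  change (g.1 ∘ π) x ≠ (g.1 ∘ π) y
  rw [hg, hf _ (by simp), hf _ (by simp), if_pos rfl, if_neg (Ne.symm hxy)]
  norm_num

/-- Dual variational formula for the resistance of the fused form: upper bound. -/
theorem resistance_fuse_le (h : q.IsResistanceForm) {J : ℕ} (u v : Fin J → F) (x y : F)
    (a : Fin J → ℝ) :
    (q.push (Quotient.mk (fuseSetoid fun j => {u j, v j}))).resistance
      (Quotient.mk _ x) (Quotient.mk _ y) ≤ fusedEnergy q.resistance u v x y a := by
  rw [← h.energy_dipole_sub_sum]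
  refine Real.sSup_le ?_ (h.nonneg _)
  rintro _ ⟨f, hf, rfl⟩
  rw [div_le_iff₀ hf, sq_abs]
  have h1 := h.cauchySchwarz (h.dipole x y - ∑ j, a j • h.dipole (u j) (v j)) (pull _ f)
  have h2 : ∀ j, (pull _ f).1 (u j) = (pull _ f).1 (v j) := fun j =>
    congrArg f.1 (fuseSetoid_mk_left_eq_right u v j)
  have h3 : q.energy (h.dipole x y - ∑ j, a j • h.dipole (u j) (v j)) (pull _ f) =
      (pull _ f).1 x - (pull _ f).1 y := by
    simp [h.energy_dipole, h2, -Subtype.coe_prop]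
  rw [h3] at h1
  exact h1

/-- Dual variational formula for the resistance of the fused form: the minimum is attained. -/
theorem exists_resistance_fuse_eq (h : q.IsResistanceForm) {J : ℕ} (u v : Fin J → F) (x y : F) :
    ∃ a : Fin J → ℝ, (q.push (Quotient.mk (fuseSetoid fun j => {u j, v j}))).resistance
      (Quotient.mk _ x) (Quotient.mk _ y) = fusedEnergy q.resistance u v x y a ∧
        spanEnergy q.resistance u v a ≤ q.resistance x y := by
  obtain ⟨a, ha⟩ := h.exists_projection (fun j => h.dipole (u j) (v j)) (h.dipole x y)
  set p := ∑ j, a j • h.dipole (u j) (v j) with hp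
  set f := h.dipole x y - p with hf
  -- The residual `f` is orthogonal to every fused dipole, hence to the projection `p`.
  -- Orthogonality to the dipoles also says `f (u j) = f (v j)`, so `f` descends and serves as an
  -- optimal test function.
  have hpf : q.energy f p = 0 := by
    rw [h.symm, hp]
    simp [ha]
  have hff : q.energy f f = f.1 x - f.1 y := by
    conv_lhs => rw [hf, map_sub, ← hf, hpf, sub_zero]
    rw [h.energy_dipole_right]
  refine ⟨a, le_antisymm (h.resistance_fuse_le u v x y a) ?_, ?_⟩
  · rw [← h.energy_dipole_sub_sum, ← hp, ← hf]
    obtain ⟨g, hg⟩ := exists_push_domain (q := q)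
      (π := Quotient.mk (fuseSetoid fun j => {u j, v j})) Quotient.mk_surjective f <|
        eq_of_fuseSetoid u v fun j => by rw [← sub_eq_zero, ← h.energy_dipole, ha]
    have hpull : pull _ g = f := Subtype.ext hg
    have h1 := (h.fuse u v).sq_sub_le g (Quotient.mk _ x) (Quotient.mk _ y)
    rw [push_energy, hpull] at h1
    have h2 : g.1 (Quotient.mk _ x) - g.1 (Quotient.mk _ y) = q.energy f f := by
      rw [hff, ← hg]; rfl
    rw [h2] at h1
    rcases (h.nonneg f).eq_or_lt with h0 | h0
    · rw [← h0]; exact resistance_nonneg _ _ _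
    · rw [sq] at h1; exact le_of_mul_le_mul_right h1 h0
  · rw [← h.energy_sum_dipole, ← hp, ← h.energy_dipole_self]
    -- By Pythagoras, the projection has no more energy than the dipole.
    have h1 : h.dipole x y = f + p := by rw [hf, sub_add_cancel]
    rw [h1]
    simp only [map_add, LinearMap.add_apply, hpf, h.symm p f]
    linarith [h.nonneg f]

/-- Dipoles with distinct poles are linearly independent, quantitatively. -/
theorem exists_sq_sum_le_spanEnergy (h : q.IsResistanceForm) {J : ℕ} (u v : Fin J → F)
    (huv : Function.Injective (Sum.elim u v)) :
    ∃ C > 0, ∀ a : Fin J → ℝ, (∑ j, |a j|) ^ 2 ≤ C * spanEnergy q.resistance u v a := by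
  classical
  -- A dual family to the dipoles, which exists because the points are distinct; pairing with it
  -- reads off the coefficients.
  have hex : ∀ j, ∃ f : q.domain, ∀ i, f.1 (u i) - f.1 (v i) = if i = j then 1 else 0 := by
    intro j
    obtain ⟨f, hf⟩ := h.exists_extension (Finset.univ.image u ∪ Finset.univ.image v)
      (fun z => if z = u j then 1 else 0)
    refine ⟨f, fun i => ?_⟩
    rw [hf _ (by simp), hf _ (by simp)]
    have h1 : v i ≠ u j := fun e => by
      have := @huv (Sum.inr i) (Sum.inl j) e
      simp at this
    have h2 : u i = u j ↔ i = j := ⟨fun e => by simpa using @huv (Sum.inl i) (Sum.inl j) e,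
      fun e => by rw [e]⟩
    simp [h1, h2]
  choose f hf using hex
  set S := ∑ j, √(q.energy (f j) (f j)) with hS
  -- The added `1` keeps the constant positive when `J = 0`.
  refine ⟨S ^ 2 + 1, by positivity, fun a => ?_⟩
  rw [← h.energy_sum_dipole]
  set p := ∑ j, a j • h.dipole (u j) (v j) with hp
  have hj : ∀ j, |a j| ≤ √(q.energy (f j) (f j)) * √(q.energy p p) := fun j => by
    have h1 : q.energy (f j) p = a j := by
      simp [hp, h.energy_dipole_right, hf, -Subtype.coe_prop]
    rw [← Real.sqrt_mul (h.nonneg _), ← Real.sqrt_sq_eq_abs, ← h1]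
    exact Real.sqrt_le_sqrt (h.cauchySchwarz _ _)
  have h1 : ∑ j, |a j| ≤ S * √(q.energy p p) := by
    rw [hS, Finset.sum_mul]
    exact Finset.sum_le_sum fun j _ => hj j
  calc (∑ j, |a j|) ^ 2 ≤ (S * √(q.energy p p)) ^ 2 := by gcongr
    _ = S ^ 2 * q.energy p p := by rw [mul_pow, Real.sq_sqrt (h.nonneg _)]
    _ ≤ _ := by linarith [h.nonneg p]

end EnergyForm.IsResistanceForm

/-! ### Fused spaces are compact resistance spaces -/

namespace FormSpace

/-- Fusing pairs of points preserves compact resistance spaces. -/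
theorem IsCompactResistanceSpace.fusePairs {X : FormSpace.{u}} (h : X.IsCompactResistanceSpace)
    {J : ℕ} (u v : Fin J → X.carrier) : (X.fusePairs u v).IsCompactResistanceSpace := by
  obtain ⟨hq, m, hd, hc, -, hB, hfin, hpos⟩ := h
  have hq' : (X.fusePairs u v).form.IsResistanceForm := hq.fuse u v
  refine ⟨hq', hq'.metricSpace, fun x y => rfl, ?_⟩
  let _ : MetricSpace (X.fusePairs u v).carrier := hq'.metricSpace
  let π : X.carrier → (X.fusePairs u v).carrier := Quotient.mk _
  have hπ : Function.Surjective π := Quotient.mk_surjective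
  have hcont : Continuous π := (LipschitzWith.mk_one fun x y => by
    rw [hd]; exact hq.resistance_push_le _ x y).continuous
  have hmeas : Measurable π := fun s hs => hs
  have hcompact : CompactSpace (X.fusePairs u v).carrier := hπ.compactSpace hcont
  -- The measurable structure is the quotient one; it is the Borel one since `π` is a continuous
  -- surjection from a compact metric, hence Polish, space.
  have hborel : BorelSpace (X.fusePairs u v).carrier := ⟨hcont.map_eq_borel hπ⟩
  have hμ : (X.fusePairs u v).μ = X.μ.map π := rfl
  refine ⟨hcompact, hq'.isRegular fun x y => rfl, hborel, ?_, ?_⟩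
  · rw [hμ]; infer_instance
  · rw [hμ]; exact hcont.isOpenPosMeasure_map hπ

end FormSpace

end

noncomputable section

/-! ### Stability of the fused resistance under small distortion -/

namespace EnergyForm

section Stability

variable {F F' : Type u} {r : F → F → ℝ} {r' : F' → F' → ℝ} {rel : F → F' → Prop} {η : ℝ}

theorem abs_crossResistance_sub_le
    (H : ∀ p p' s s', rel p p' → rel s s' → |r p s - r' p' s'| ≤ η) {x y z w : F}
    {x' y' z' w' : F'} (hx : rel x x') (hy : rel y y') (hz : rel z z') (hw : rel w w') :
    |crossResistance r x y z w - crossResistance r' x' y' z' w'| ≤ 2 * η := by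
  have h1 := abs_le.1 (H _ _ _ _ hx hw)
  have h2 := abs_le.1 (H _ _ _ _ hy hz)
  have h3 := abs_le.1 (H _ _ _ _ hx hz)
  have h4 := abs_le.1 (H _ _ _ _ hy hw)
  simp only [crossResistance]
  rw [abs_le]
  constructor <;> linarith [h1.1, h1.2, h2.1, h2.2, h3.1, h3.2, h4.1, h4.2]

theorem abs_sum_mul_sub_le {J : ℕ} (a b b' : Fin J → ℝ) {c : ℝ} (h : ∀ j, |b j - b' j| ≤ c) :
    |∑ j, a j * b j - ∑ j, a j * b' j| ≤ (∑ j, |a j|) * c := by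
  rw [← Finset.sum_sub_distrib, Finset.sum_mul]
  refine (Finset.abs_sum_le_sum_abs _ _).trans (Finset.sum_le_sum fun j _ => ?_)
  rw [← mul_sub, abs_mul]
  exact mul_le_mul_of_nonneg_left (h j) (abs_nonneg _)

theorem abs_spanEnergy_sub_le
    (H : ∀ p p' s s', rel p p' → rel s s' → |r p s - r' p' s'| ≤ η) {J : ℕ} {u v : Fin J → F}
    {u' v' : Fin J → F'} (hu : ∀ j, rel (u j) (u' j)) (hv : ∀ j, rel (v j) (v' j))
    (a : Fin J → ℝ) :
    |spanEnergy r u v a - spanEnergy r' u' v' a| ≤ 2 * η * (∑ j, |a j|) ^ 2 := by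
  simp only [spanEnergy, ← Finset.mul_sum]
  refine (abs_sum_mul_sub_le a _ _ fun i => abs_sum_mul_sub_le a _ _ fun j =>
    abs_crossResistance_sub_le H (hu i) (hv i) (hu j) (hv j)).trans_eq ?_
  ring

/-- With `A = ∑ j, |a j|`, the constant, linear and quadratic terms contribute `η`, `4 * η * A` and
`2 * η * A ^ 2`; the bound completes the square. -/
theorem abs_fusedEnergy_sub_le
    (H : ∀ p p' s s', rel p p' → rel s s' → |r p s - r' p' s'| ≤ η) {J : ℕ} {u v : Fin J → F}
    {u' v' : Fin J → F'} (hu : ∀ j, rel (u j) (u' j)) (hv : ∀ j, rel (v j) (v' j))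
    {x y : F} {x' y' : F'} (hx : rel x x') (hy : rel y y') (a : Fin J → ℝ) :
    |fusedEnergy r u v x y a - fusedEnergy r' u' v' x' y' a| ≤ 2 * η * (1 + ∑ j, |a j|) ^ 2 := by
  have h1 := H _ _ _ _ hx hy
  have h2 := abs_le.1 (abs_sum_mul_sub_le a _ _ fun j =>
    abs_crossResistance_sub_le H hx hy (hu j) (hv j))
  have h3 := abs_le.1 (abs_spanEnergy_sub_le H hu hv a)
  have h0 : 0 ≤ η := (abs_nonneg _).trans h1
  rw [abs_le] at h1 ⊢
  simp only [fusedEnergy]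
  constructor <;> nlinarith [h1.1, h1.2, h2.1, h2.2, h3.1, h3.2]

end Stability

namespace IsResistanceForm

variable {F F' : Type u} {q : EnergyForm F} {q' : EnergyForm F'}

/-- The resistance of a fused form depends continuously on the resistance of the form, uniformly
in the two points. -/
theorem abs_resistance_fuse_sub_le (h : q.IsResistanceForm) (h' : q'.IsResistanceForm)
    {rel : F → F' → Prop} {η : ℝ}
    (H : ∀ p p' s s', rel p p' → rel s s' → |q.resistance p s - q'.resistance p' s'| ≤ η)
    {J : ℕ} {u v : Fin J → F} {u' v' : Fin J → F'} (hu : ∀ j, rel (u j) (u' j))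
    (hv : ∀ j, rel (v j) (v' j)) {C D : ℝ} (hC : 0 < C)
    (hCa : ∀ a : Fin J → ℝ, (∑ j, |a j|) ^ 2 ≤ C * spanEnergy q'.resistance u' v' a)
    (hD : ∀ x y, q'.resistance x y ≤ D) (hη : η ≤ 1) (hηC : 4 * C * η ≤ 1)
    {x y : F} {x' y' : F'} (hx : rel x x') (hy : rel y y') :
    |(q.push (Quotient.mk (fuseSetoid fun j => {u j, v j}))).resistance
        (Quotient.mk _ x) (Quotient.mk _ y) -
      (q'.push (Quotient.mk (fuseSetoid fun j => {u' j, v' j}))).resistance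
        (Quotient.mk _ x') (Quotient.mk _ y')| ≤ 2 * η * (1 + √(2 * C * (D + 1))) ^ 2 := by
  have hxy := H _ _ _ _ hx hy
  have hη0 : 0 ≤ η := (abs_nonneg _).trans hxy
  have key : ∀ a : Fin J → ℝ, ∑ j, |a j| ≤ √(2 * C * (D + 1)) →
      |fusedEnergy q.resistance u v x y a - fusedEnergy q'.resistance u' v' x' y' a| ≤
        2 * η * (1 + √(2 * C * (D + 1))) ^ 2 := fun a ha =>
    (abs_fusedEnergy_sub_le H hu hv hx hy a).trans (by gcongr)
  rw [abs_le] at hxy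
  obtain ⟨a, ha, haS⟩ := h.exists_resistance_fuse_eq u v x y
  obtain ⟨b, hb, hbS⟩ := h'.exists_resistance_fuse_eq u' v' x' y'
  have hR' := hD x' y'
  have hR'0 := resistance_nonneg q' x' y'
  -- Coercivity is known only for `q'`, while `a` is optimal for `q`. Transferring it costs `2 * C *
  -- η * (∑ j, |a j|) ^ 2`, at most half of the left side by `4 * C * η ≤ 1`, and can be absorbed.
  have ka := abs_le.1 <| key a <| Real.le_sqrt_of_sq_le <| by
    have h1 := (abs_le.1 (abs_spanEnergy_sub_le H hu hv a)).1
    have h2 := hCa a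
    have h3 : spanEnergy q'.resistance u' v' a ≤ D + 1 + 2 * η * (∑ j, |a j|) ^ 2 := by linarith
    have h4 := mul_le_mul_of_nonneg_left h3 hC.le
    have h5 := mul_le_mul_of_nonneg_right hηC (sq_nonneg (∑ j, |a j|))
    linarith
  have kb := abs_le.1 <| key b <| Real.le_sqrt_of_sq_le <| by
    have h2 := hCa b
    have h4 := mul_le_mul_of_nonneg_left (hbS.trans hR') hC.le
    have h5 : 0 ≤ C * (D + 1) := mul_nonneg hC.le (by linarith)
    linarith
  -- Each minimiser is used as a competitor for the other form.
  have h1 := h.resistance_fuse_le u v x y b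
  have h2 := h'.resistance_fuse_le u' v' x' y' a
  rw [abs_le]
  constructor <;> linarith [ka.1, ka.2, kb.1, kb.2]

end IsResistanceForm

end EnergyForm

/-! ### Prohorov distance of image measures -/

namespace MeasureTheory

open Metric

variable {X Y M N : Type*} [MeasurableSpace X] [MeasurableSpace Y]
  [MetricSpace M] [MeasurableSpace M] [BorelSpace M]
  [MetricSpace N] [MeasurableSpace N] [BorelSpace N]

/-- The hypothesis is tested on `f '' (f' ⁻¹' B)`, measurable because `f` is a measurable embedding;
points of `Y` that `g` sends near this set are sent near `B` by `g'`. -/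
theorem measure_map_le_thickening {μ : Measure X} {ν : Measure Y} {f : X → M} {g : Y → M}
    {f' : X → N} {g' : Y → N} (hf : MeasurableEmbedding f) (hg : Measurable g)
    (hf' : Measurable f') (hg' : Measurable g') {δ ε : ℝ≥0∞} (hε : ε < ∞) (hδε : δ ≤ ε)
    (hle : ∀ B, MeasurableSet B → μ.map f B ≤ ν.map g (thickening δ.toReal B) + δ)
    (hclose : ∀ x y, edist (f x) (g y) < δ → edist (f' x) (g' y) < ε)
    {B : Set N} (hB : MeasurableSet B) :
    μ.map f' B ≤ ν.map g' (thickening ε.toReal B) + ε := by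
  have h1 := hle _ (hf.measurableSet_image.2 (hf' hB))
  rw [hf.map_apply, Set.preimage_image_eq _ hf.injective,
    Measure.map_apply hg isOpen_thickening.measurableSet] at h1
  rw [Measure.map_apply hf' hB, Measure.map_apply hg' isOpen_thickening.measurableSet]
  refine h1.trans (add_le_add (measure_mono fun y hy => ?_) hδε)
  obtain ⟨_, ⟨x, hx, rfl⟩, hxy⟩ := mem_thickening_iff.1 hy
  refine mem_thickening_iff.2 ⟨f' x, hx, ?_⟩
  have h2 := hclose x y (by
    rw [edist_comm, edist_dist]
    exact (ENNReal.ofReal_lt_iff_lt_toReal dist_nonneg (hδε.trans_lt hε).ne).2 hxy)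
  rw [edist_comm, edist_dist] at h2
  exact (ENNReal.ofReal_lt_iff_lt_toReal dist_nonneg hε.ne).1 h2

/-- Transfer of a bound on the Lévy–Prokhorov distance between image measures. -/
theorem levyProkhorovEDist_map_le {μ : Measure X} {ν : Measure Y} {f : X → M} {g : Y → M}
    {f' : X → N} {g' : Y → N} (hf : MeasurableEmbedding f) (hg : MeasurableEmbedding g)
    (hf' : Measurable f') (hg' : Measurable g') {δ ε : ℝ≥0∞} (hδε : δ ≤ ε)
    (hlt : levyProkhorovEDist (μ.map f) (ν.map g) < δ)
    (hclose : ∀ x y, edist (f x) (g y) < δ → edist (f' x) (g' y) ≤ ε) :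
    levyProkhorovEDist (μ.map f') (ν.map g') ≤ ε := by
  refine levyProkhorovEDist_le_of_forall _ _ _ fun ε' B hε' htop hB => ⟨?_, ?_⟩
  · exact measure_map_le_thickening hf hg.measurable hf' hg' htop (hδε.trans hε'.le)
      (fun B hB => left_measure_le_of_levyProkhorovEDist_lt hlt hB)
      (fun x y h => (hclose x y h).trans_lt hε') hB
  · exact measure_map_le_thickening hg hf.measurable hg' hf' htop (hδε.trans hε'.le)
      (fun B hB => right_measure_le_of_levyProkhorovEDist_lt hlt hB)
      (fun y x h => by rw [edist_comm] at h ⊢; exact (hclose x y h).trans_lt hε') hB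

end MeasureTheory

/-! ### Gluing two quotients along a correspondence -/

namespace FormSpace

open MeasureTheory Metric

/-- If a common embedding of two spaces has small cost and the correspondence that it defines
has small distortion for two quotients of the spaces, then these are close. -/
theorem ghvDist_le_of_quotient {X Y X₁ Y₁ : FormSpace.{u}} (hX : X.IsCompactResistanceSpace)
    (hY : Y.IsCompactResistanceSpace) (hX₁ : X₁.IsCompactResistanceSpace)
    (hY₁ : Y₁.IsCompactResistanceSpace) {π : X.carrier → X₁.carrier} {π' : Y.carrier → Y₁.carrier}
    (hπ : Function.Surjective π) (hπ' : Function.Surjective π') (hm : Measurable π)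
    (hm' : Measurable π') (hμ : X₁.μ = X.μ.map π) (hμ' : Y₁.μ = Y.μ.map π')
    (hρ : X₁.ρ = π X.ρ) (hρ' : Y₁.ρ = π' Y.ρ) (e : CommonEmbedding X Y) {δ : ℝ≥0∞} {ε : ℝ}
    (hε : 0 < ε) (hδ : δ ≤ ENNReal.ofReal ε) (hcost : e.cost < δ)
    (hdist : ∀ x x' y y', edist (e.left x) (e.right x') < δ → edist (e.left y) (e.right y') < δ →
      |X₁.R (π x) (π y) - Y₁.R (π' x') (π' y')| ≤ 2 * ε) :
    ghvDist X₁ Y₁ ≤ 3 * ENNReal.ofReal ε := by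
  obtain ⟨-, mX, dX, cX, -, bX, -, -⟩ := hX
  obtain ⟨-, mY, dY, cY, -, bY, -, -⟩ := hY
  obtain ⟨-, mX₁, dX₁, cX₁, -, bX₁, -, -⟩ := hX₁
  obtain ⟨-, mY₁, dY₁, cY₁, -, bY₁, -, -⟩ := hY₁
  have hH : hausdorffEDist (Set.range e.left) (Set.range e.right) < δ :=
    lt_of_le_of_lt (le_add_right le_self_add) hcost
  have hP : e.prohorov < δ := lt_of_le_of_lt (le_add_right le_add_self) hcost
  have hR : edist (e.left X.ρ) (e.right Y.ρ) < δ := lt_of_le_of_lt le_add_self hcost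
  let Z := {p : X.carrier × Y.carrier // edist (e.left p.1) (e.right p.2) < δ}
  let Φ : Z → X₁.carrier := fun p => π p.1.1
  let Ψ : Z → Y₁.carrier := fun p => π' p.1.2
  have : Nonempty Z := ⟨⟨(X.ρ, Y.ρ), hR⟩⟩
  -- Distortion at most `2 * ε` is exactly what allows both metrics to extend to the disjoint union
  -- with corresponding points at distance `ε`.
  let mN : MetricSpace (X₁.carrier ⊕ Y₁.carrier) := glueMetricApprox Φ Ψ ε hε fun p s => by
    rw [dX₁, dY₁]; exact hdist _ _ _ _ p.2 s.2
  have hinl : Isometry (Sum.inl : X₁.carrier → X₁.carrier ⊕ Y₁.carrier) :=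
    Isometry.of_dist_eq fun _ _ => rfl
  have hinr : Isometry (Sum.inr : Y₁.carrier → X₁.carrier ⊕ Y₁.carrier) :=
    Isometry.of_dist_eq fun _ _ => rfl
  have hclose : ∀ x y, edist (e.left x) (e.right y) < δ →
      edist (Sum.inl (π x) : X₁.carrier ⊕ Y₁.carrier) (Sum.inr (π' y)) ≤ ENNReal.ofReal ε := by
    intro x y hxy
    rw [edist_dist]
    exact ENNReal.ofReal_le_ofReal (glueDist_glued_points Φ Ψ ε ⟨(x, y), hxy⟩).le
  let e₁ : CommonEmbedding X₁ Y₁ :=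
    { M := X₁.carrier ⊕ Y₁.carrier
      metric := mN
      left := Sum.inl
      right := Sum.inr
      left_isom := fun x y => (hinl.dist_eq x y).trans (dX₁ x y)
      right_isom := fun x y => (hinr.dist_eq x y).trans (dY₁ x y) }
  have hleft : Isometry e.left := Isometry.of_dist_eq fun x y => by rw [e.left_isom, dX]
  have hright : Isometry e.right := Isometry.of_dist_eq fun x y => by rw [e.right_isom, dY]
  have h1 : hausdorffEDist (Set.range e₁.left) (Set.range e₁.right) ≤ ENNReal.ofReal ε := by
    refine hausdorffEDist_le_of_mem_edist ?_ ?_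
    · rintro _ ⟨x, rfl⟩
      obtain ⟨x, rfl⟩ := hπ x
      obtain ⟨_, ⟨y, rfl⟩, hxy⟩ := exists_edist_lt_of_hausdorffEDist_lt (Set.mem_range_self x) hH
      exact ⟨_, ⟨π' y, rfl⟩, hclose x y hxy⟩
    · rintro _ ⟨y, rfl⟩
      obtain ⟨y, rfl⟩ := hπ' y
      rw [hausdorffEDist_comm] at hH
      obtain ⟨_, ⟨x, rfl⟩, hxy⟩ := exists_edist_lt_of_hausdorffEDist_lt (Set.mem_range_self y) hH
      rw [edist_comm] at hxy
      refine ⟨_, ⟨π x, rfl⟩, ?_⟩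
      rw [edist_comm]
      exact hclose x y hxy
  have h2 : e₁.prohorov ≤ ENNReal.ofReal ε := by
    let _ : MeasurableSpace e.M := borel e.M
    have : BorelSpace e.M := ⟨rfl⟩
    let _ : MeasurableSpace (X₁.carrier ⊕ Y₁.carrier) := borel _
    have : BorelSpace (X₁.carrier ⊕ Y₁.carrier) := ⟨rfl⟩
    have hl := hinl.continuous.measurable
    have hr := hinr.continuous.measurable
    have := levyProkhorovEDist_map_le (μ := X.μ) (ν := Y.μ)
      hleft.isClosedEmbedding.measurableEmbedding
      hright.isClosedEmbedding.measurableEmbedding (hl.comp hm) (hr.comp hm') hδ hP hclose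
    rw [← Measure.map_map hl hm, ← Measure.map_map hr hm', ← hμ, ← hμ'] at this
    exact this
  have h3 : edist (e₁.left X₁.ρ) (e₁.right Y₁.ρ) ≤ ENNReal.ofReal ε := by
    rw [hρ, hρ']; exact hclose _ _ hR
  calc ghvDist X₁ Y₁ ≤ e₁.cost := iInf_le _ _
    _ ≤ ENNReal.ofReal ε + ENNReal.ofReal ε + ENNReal.ofReal ε := add_le_add (add_le_add h1 h2) h3
    _ = 3 * ENNReal.ofReal ε := by ring

end FormSpace

end

/-! ### Convergence of the fused spaces -/

theorem mainTheorem4 (J : ℕ)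
    (X : ℕ → FormSpace.{u}) (u v : (n : ℕ) → Fin J → (X n).carrier)
    (X' : FormSpace.{u}) (u' v' : Fin J → X'.carrier)
    (hX : ∀ n, (X n).IsCompactResistanceSpace)
    (hX' : X'.IsCompactResistanceSpace)
    (hdistinct : Function.Injective (Sum.elim u' v'))
    (hconv : Filter.Tendsto
      (fun n => FormSpace.markedGhvDist (X n) (u n) (v n) X' u' v') Filter.atTop (nhds 0)) :
    (∀ n, ((X n).fusePairs (u n) (v n)).IsCompactResistanceSpace) ∧
    (X'.fusePairs u' v').IsCompactResistanceSpace ∧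
    Filter.Tendsto
      (fun n => FormSpace.ghvDist ((X n).fusePairs (u n) (v n)) (X'.fusePairs u' v'))
      Filter.atTop (nhds 0) := by
  refine ⟨fun n => (hX n).fusePairs _ _, hX'.fusePairs _ _, ?_⟩
  obtain ⟨C, hC, hCa⟩ := hX'.1.exists_sq_sum_le_spanEnergy u' v' hdistinct
  obtain ⟨D, hD⟩ : ∃ D, ∀ x y, X'.form.resistance x y ≤ D := by
    obtain ⟨-, m, hd, hc, -⟩ := hX'
    obtain ⟨D, hD⟩ := Metric.isBounded_iff.1 (isCompact_univ (X := X'.carrier)).isBounded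
    exact ⟨D, fun x y => (hd x y).symm.trans_le (hD trivial trivial)⟩
  rw [ENNReal.tendsto_nhds_zero]
  intro ε hε
  obtain ⟨t, ht, htε⟩ : ∃ t : ℝ, 0 < t ∧ 3 * ENNReal.ofReal t ≤ ε := by
    obtain ⟨s, hs, hsε⟩ := ENNReal.lt_iff_exists_nnreal_btwn.1 hε
    refine ⟨s / 3, div_pos (by exact_mod_cast hs) (by norm_num), ?_⟩
    rw [← ENNReal.ofReal_ofNat 3, ← ENNReal.ofReal_mul (by norm_num), mul_div_cancel₀ _ (by norm_num),
      ENNReal.ofReal_coe_nnreal]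
    exact hsε.le
  set B := (1 + √(2 * C * (D + 1))) ^ 2 with hB
  have hBpos : 0 < B := by positivity
  -- Pairs at distance below `δ` form a correspondence of distortion `η = 2 * δ`. The next two
  -- bounds are the smallness conditions on `η` in the stability estimate; the last brings the fused
  -- distortion below the `2 * t` needed for gluing.
  obtain ⟨δ, hδ, hδt, hδ1, hδC, hδB⟩ : ∃ δ : ℝ, 0 < δ ∧ δ ≤ t ∧ 2 * δ ≤ 1 ∧ 4 * C * (2 * δ) ≤ 1 ∧
      2 * (2 * δ) * B ≤ 2 * t := by
    refine ⟨min (min t (1 / 2)) (min (1 / (8 * C)) (t / (2 * B))), by positivity,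
      (min_le_left _ _).trans (min_le_left _ _), ?_, ?_, ?_⟩
    · have := (min_le_left (min t (1 / 2)) (min (1 / (8 * C)) (t / (2 * B)))).trans
        (min_le_right _ _)
      linarith
    · have := (min_le_right (min t (1 / 2)) (min (1 / (8 * C)) (t / (2 * B)))).trans
        (min_le_left _ _)
      rw [le_div_iff₀ (by positivity)] at this
      linarith
    · have := (min_le_right (min t (1 / 2)) (min (1 / (8 * C)) (t / (2 * B)))).trans
        (min_le_right _ _)
      rw [le_div_iff₀ (by positivity)] at this
      linarith
  filter_upwards [hconv.eventually_lt_const (ENNReal.ofReal_pos.2 hδ)] with n hn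
  obtain ⟨e, he⟩ := iInf_lt_iff.1 hn
  -- The marked terms of the cost put the fused points themselves into the correspondence.
  have hsum : ∀ j, edist (e.left (u n j)) (e.right (u' j)) +
      edist (e.left (v n j)) (e.right (v' j)) < ENNReal.ofReal δ := fun j =>
    lt_of_le_of_lt ((Finset.single_le_sum
      (f := fun j => edist (e.left (u n j)) (e.right (u' j)) +
        edist (e.left (v n j)) (e.right (v' j)))
      (fun _ _ => zero_le) (Finset.mem_univ j)).trans le_add_self) he
  have hdist : ∀ p p' s s', edist (e.left p) (e.right p') < ENNReal.ofReal δ →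
      edist (e.left s) (e.right s') < ENNReal.ofReal δ →
        |(X n).form.resistance p s - X'.form.resistance p' s'| ≤ 2 * δ := by
    intro p p' s s' hp hs
    rw [edist_lt_ofReal] at hp hs
    have h1 : (X n).form.resistance p s = dist (e.left p) (e.left s) := (e.left_isom p s).symm
    have h2 : X'.form.resistance p' s' = dist (e.right p') (e.right s') := (e.right_isom p' s').symm
    rw [h1, h2, ← Real.dist_eq]
    exact (dist_dist_dist_le _ _ _ _).trans (by linarith)
  refine le_trans (FormSpace.ghvDist_le_of_quotient (hX n) hX' ((hX n).fusePairs (u n) (v n))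
    (hX'.fusePairs u' v') (π := Quotient.mk _) (π' := Quotient.mk _) Quotient.mk_surjective
    Quotient.mk_surjective (fun _ h => h) (fun _ h => h) rfl rfl rfl rfl e ht
    (ENNReal.ofReal_le_ofReal hδt) (lt_of_le_of_lt le_self_add he) fun x x' y y' hx hy => ?_) htε
  exact ((hX n).1.abs_resistance_fuse_sub_le hX'.1 hdist
    (fun j => lt_of_le_of_lt le_self_add (hsum j)) (fun j => lt_of_le_of_lt le_add_self (hsum j))
    hC hCa hD hδ1 hδC hx hy).trans hδB
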